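/- Let $d\ge 2$ and $N\ge 2$ be integers, and let $T_N$ be the map $(x_1,\dots,x_d)\mapsto (Nx_1 \bmod 1,\dots,Nx_d \bmod 1)$ on the $d$-dimensional torus $\mathbb{R}^d/\mathbb{Z}^d$, identified with $[0,1]^d$ (points of $[0,1]^d$ that differ by an element of $\mathbb{Z}^d$ represent the same point of the torus). Let $K\subsetneq[0,1]^d$ be a closed $T_N$-invariant set, that is, for every $x\in K$ there is $y\in K$ with $Nx-y\in\mathbb{Z}^d$. Then there are a constant $c<1$, a finite set $\mathcal{V}$ of non-zero vectors in $\mathbb{R}^d$, and sets $E_v$ $(v\in\mathcal{V})$ such that $$K=\bigcup_{v\in\mathcal{V}}E_v$$ and, for every $v\in\mathcal{V}$, the image of $E_v$ under the orthogonal projection of $\mathbb{R}^d$ onto the line spanned by $v$ has Hausdorff dimension $<c$. -/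

import Mathlib

/-- The closed unit cube `[0,1]^d` in Euclidean space. -/
def unitCube (d : ℕ) : Set (EuclideanSpace ℝ (Fin d)) :=
  {x | ∀ i, x i ∈ Set.Icc (0 : ℝ) 1}

/-- The quotient map from `ℝ^d` to the `d`-dimensional torus `(ℝ/ℤ)^d`; its restriction to the
unit cube is the identification of the cube (opposite faces glued) with the torus. -/
def toTorus (d : ℕ) (x : EuclideanSpace ℝ (Fin d)) : Fin d → UnitAddCircle :=
  fun i => (x i : UnitAddCircle)

/-- The map `T_N`, `(x_1, …, x_d) ↦ (N x_1 mod 1, …, N x_d mod 1)`, on the torus. -/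
def timesN (d N : ℕ) (t : Fin d → UnitAddCircle) : Fin d → UnitAddCircle :=
  fun i => N • t i

/-- A subset `K` of `[0,1]^d` is `T_N`-invariant if the subset of the torus that it represents
is mapped into itself by `T_N`: for each `x ∈ K`, the point `N x` agrees modulo `ℤ^d` with a
point of `K`. -/
def IsTimesNInvariant (d N : ℕ) (K : Set (EuclideanSpace ℝ (Fin d))) : Prop :=
  Set.MapsTo (timesN d N) (toTorus d '' K) (toTorus d '' K)

/-- The image of `E` under the projection in direction `v`, that is, under the orthogonal
projection of `ℝ^d` onto the line spanned by `v`. -/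
noncomputable def projectionInDirection {d : ℕ} (v : EuclideanSpace ℝ (Fin d))
    (E : Set (EuclideanSpace ℝ (Fin d))) : Set (EuclideanSpace ℝ (Fin d)) :=
  (Submodule.span ℝ {v}).starProjection '' E

open Filter Topology MeasureTheory
open scoped ENNReal NNReal

/-! Orbits of points of `K` avoid an open subset of the torus, so they do not equidistribute. By a
quantitative Weyl criterion (`exists_finset_mFourier_sum_large`), a finite set of nonzero
frequencies `k` and one `η > 0` witness this for every sequence in the image of `K` and every length
`n`.

As `η` works for all sequences, it also serves the orbit under `T_M`, `M = N ^ m`, with `m` chosen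
afterwards. The character `k` at the `j`-th point of that orbit is `exp (2πi M^j y)` with `y = ⟨k,
x⟩`. By pigeonhole some `k` has averages at least `η` for infinitely many `n`; the set `E_v`
collects the `x` for which `v = k` does.

Such `y` form a set of dimension less than one (`exists_dimH_frequently_large_sum_le`): for large
`M`, `exp (2πi M^j y)` is nearly a root of unity given by one base-`M` digit, and a Chernoff bound
makes digit words with large sums exponentially rare. The projection of `E_v` is a Lipschitz image
of a subset of that set. -/

/-! ### Covering and large-deviation estimates -/

/-- Borel–Cantelli for Hausdorff measure: the families of level at least `n` still cover `S`, and
their cost is the tail of a convergent series. -/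
theorem dimH_le_of_frequently_mem_cover {X : Type*} [EMetricSpace X] {ι : ℕ → Type*}
    [∀ n, Countable (ι n)] {b : ℝ≥0∞} (hb : b < 1) (t : ∀ n, ι n → Set X)
    (ht : ∀ n i, Metric.ediam (t n i) ≤ b ^ n) {s : ℝ≥0}
    (hsum : ∑' n, ∑' i, Metric.ediam (t n i) ^ (s : ℝ) ≠ ∞) {S : Set X}
    (hS : ∀ x ∈ S, ∃ᶠ n in atTop, ∃ i, x ∈ t n i) : dimH S ≤ s := by
  borelize X
  have hle : μH[(s : ℝ)] S ≤
      liminf (fun n => ∑' p : Σ k, ι (k + n), Metric.ediam (t (p.1 + n) p.2) ^ (s : ℝ)) atTop := by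
    refine Measure.hausdorffMeasure_le_liminf_tsum (s : ℝ) S (fun n => b ^ n)
      (ENNReal.tendsto_pow_atTop_nhds_zero_of_lt_one hb)
      (fun n (p : Σ k, ι (k + n)) => t (p.1 + n) p.2) ?_ ?_
    · exact Eventually.of_forall fun n p =>
        (ht _ _).trans (pow_le_pow_right_of_le_one' hb.le (Nat.le_add_left _ _))
    · refine Eventually.of_forall fun n x hx => ?_
      obtain ⟨m, hm, i, hi⟩ := (frequently_atTop.1 (hS x hx)) n
      obtain ⟨k, rfl⟩ := Nat.exists_eq_add_of_le' hm
      exact Set.mem_iUnion.2 ⟨⟨k, i⟩, hi⟩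
  have h0 : Tendsto (fun n => ∑' p : Σ k, ι (k + n), Metric.ediam (t (p.1 + n) p.2) ^ (s : ℝ))
      atTop (𝓝 0) := by
    simp_rw [ENNReal.tsum_sigma']
    exact ENNReal.tendsto_sum_nat_add (fun n => ∑' i, Metric.ediam (t n i) ^ (s : ℝ)) hsum
  rw [h0.liminf_eq] at hle
  exact dimH_le_of_hausdorffMeasure_ne_top (ne_top_of_le_ne_top ENNReal.zero_ne_top hle)

/-- Chernoff's method at `t = σ / 2`, which minimises `t ^ 2 - t * σ`. The bound `exp u ≤ 1 + u + u
^ 2` needs `|u| ≤ 1`, hence `σ ≤ 2`. -/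
theorem card_words_sum_ge_le {α : Type*} [Fintype α] {x : α → ℝ} (hx : ∀ a, |x a| ≤ 1)
    (hx0 : ∑ a, x a = 0) {σ : ℝ} (hσ : 0 ≤ σ) (hσ2 : σ ≤ 2) (n : ℕ) :
    (Nat.card {w : Fin n → α // σ * n ≤ ∑ i, x (w i)} : ℝ) ≤
      (Fintype.card α * Real.exp (-(σ ^ 2 / 4))) ^ n := by
  classical
  set t := σ / 2 with ht
  have hmgf : ∑ a, Real.exp (t * x a) ≤ Fintype.card α * Real.exp (t ^ 2) := by
    have hterm : ∀ a, Real.exp (t * x a) ≤ (1 + t ^ 2) + t * x a := by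
      intro a
      have h1 : |t * x a| ≤ t := by
        rw [abs_mul, abs_of_nonneg (by positivity : 0 ≤ t)]
        exact mul_le_of_le_one_right (by positivity) (hx a)
      have h2 := (abs_le.1 (Real.abs_exp_sub_one_sub_id_le (h1.trans (by linarith)))).2
      have h3 : (t * x a) ^ 2 ≤ t ^ 2 := sq_le_sq.2 (h1.trans (le_abs_self t))
      linarith
    calc ∑ a, Real.exp (t * x a) ≤ ∑ a, ((1 + t ^ 2) + t * x a) :=
          Finset.sum_le_sum fun a _ => hterm a
      _ = Fintype.card α * (1 + t ^ 2) := by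
          rw [Finset.sum_add_distrib, ← Finset.mul_sum, hx0]; simp [mul_add]
      _ ≤ _ := by
          have := Real.add_one_le_exp (t ^ 2)
          gcongr; linarith
  have hcount : (Nat.card {w : Fin n → α // σ * n ≤ ∑ i, x (w i)} : ℝ) * Real.exp (t * (σ * n)) ≤
      (∑ a, Real.exp (t * x a)) ^ n := by
    rw [Fintype.sum_pow, Nat.card_eq_fintype_card, Fintype.card_subtype, ← nsmul_eq_mul,
      ← Finset.sum_const]
    refine (Finset.sum_le_sum fun w hw => ?_).trans
      (Finset.sum_le_univ_sum_of_nonneg fun w => Finset.prod_nonneg fun i _ => (Real.exp_pos _).le)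
    rw [← Real.exp_sum, ← Finset.mul_sum]
    have := (Finset.mem_filter.1 hw).2
    gcongr
  have h1 : (Nat.card {w : Fin n → α // σ * n ≤ ∑ i, x (w i)} : ℝ) * Real.exp (t * (σ * n)) ≤
      (Fintype.card α * Real.exp (t ^ 2)) ^ n :=
    hcount.trans (pow_le_pow_left₀ (Finset.sum_nonneg fun _ _ => (Real.exp_pos _).le) hmgf n)
  rw [← le_div_iff₀ (Real.exp_pos _)] at h1
  refine h1.trans (le_of_eq ?_)
  rw [mul_pow, mul_pow, mul_div_assoc, ← Real.exp_nat_mul, ← Real.exp_nat_mul, ← Real.exp_sub]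
  congr 2
  rw [ht]; ring

/-- A complex number of norm at least `2 * σ * n` has one of `±re`, `±im` at least `σ * n`, which
gives the factor 4. -/
theorem card_words_norm_sum_ge_le {α : Type*} [Fintype α] {z : α → ℂ} (hz : ∀ a, ‖z a‖ ≤ 1)
    (hz0 : ∑ a, z a = 0) {σ : ℝ} (hσ : 0 ≤ σ) (hσ2 : σ ≤ 2) (n : ℕ) :
    (Nat.card {w : Fin n → α // 2 * σ * n ≤ ‖∑ i, z (w i)‖} : ℝ) ≤
      4 * (Fintype.card α * Real.exp (-(σ ^ 2 / 4))) ^ n := by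
  classical
  have hre : ∑ a, (z a).re = 0 := by rw [← Complex.re_sum, hz0, Complex.zero_re]
  have him : ∑ a, (z a).im = 0 := by rw [← Complex.im_sum, hz0, Complex.zero_im]
  have hbre : ∀ a, |(z a).re| ≤ 1 := fun a => (Complex.abs_re_le_norm _).trans (hz a)
  have hbim : ∀ a, |(z a).im| ≤ 1 := fun a => (Complex.abs_im_le_norm _).trans (hz a)
  have h1 := card_words_sum_ge_le hbre hre hσ hσ2 n
  have h2 := card_words_sum_ge_le hbim him hσ hσ2 n
  have h3 := card_words_sum_ge_le (x := fun a => -(z a).re) (by simpa using hbre)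
    (by simpa using hre) hσ hσ2 n
  have h4 := card_words_sum_ge_le (x := fun a => -(z a).im) (by simpa using hbim)
    (by simpa using him) hσ hσ2 n
  simp only [Nat.card_eq_fintype_card, Fintype.card_subtype] at h1 h2 h3 h4 ⊢
  set A := Finset.univ.filter fun w : Fin n → α => σ * n ≤ ∑ i, (z (w i)).re
  set B := Finset.univ.filter fun w : Fin n → α => σ * n ≤ ∑ i, (z (w i)).im
  set C := Finset.univ.filter fun w : Fin n → α => σ * n ≤ ∑ i, -(z (w i)).re
  set D := Finset.univ.filter fun w : Fin n → α => σ * n ≤ ∑ i, -(z (w i)).im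
  have hsub : (Finset.univ.filter fun w : Fin n → α => 2 * σ * n ≤ ‖∑ i, z (w i)‖) ⊆
      (A ∪ B) ∪ (C ∪ D) := by
    intro w hw
    have hw := (Finset.mem_filter.1 hw).2
    have hle := Complex.norm_le_abs_re_add_abs_im (∑ i, z (w i))
    simp only [A, B, C, D, Finset.mem_union, Finset.mem_filter, Finset.mem_univ, true_and,
      Finset.sum_neg_distrib, ← Complex.re_sum, ← Complex.im_sum]
    by_contra! hcon
    have hr : |(∑ i, z (w i)).re| < σ * n := abs_lt.2 ⟨by linarith [hcon.2.1], hcon.1.1⟩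
    have hi : |(∑ i, z (w i)).im| < σ * n := abs_lt.2 ⟨by linarith [hcon.2.2], hcon.1.2⟩
    linarith
  have hc : (Finset.univ.filter fun w : Fin n → α => 2 * σ * n ≤ ‖∑ i, z (w i)‖).card ≤
      (A.card + B.card) + (C.card + D.card) :=
    (Finset.card_le_card hsub).trans ((Finset.card_union_le _ _).trans
      (add_le_add (Finset.card_union_le _ _) (Finset.card_union_le _ _)))
  have hc' : ((Finset.univ.filter fun w : Fin n → α => 2 * σ * n ≤ ‖∑ i, z (w i)‖).card : ℝ) ≤
      (A.card + B.card) + (C.card + D.card) := by exact_mod_cast hc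
  linarith

/-! ### Quantitative Weyl criterion -/

theorem integral_fourier_haarAddCircle {T : ℝ} [hT : Fact (0 < T)] {n : ℤ} (hn : n ≠ 0) :
    ∫ t : AddCircle T, fourier n t ∂AddCircle.haarAddCircle = 0 :=
  integral_eq_zero_of_add_right_eq_neg (fourier_add_half_inv_index hn hT.out)

theorem integral_mFourier {ι : Type*} [Fintype ι] {k : ι → ℤ} (hk : k ≠ 0) :
    ∫ t, UnitAddTorus.mFourier k t ∂(Measure.pi fun _ : ι => AddCircle.haarAddCircle) = 0 := by
  obtain ⟨i, hi⟩ := Function.ne_iff.1 hk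
  simp only [UnitAddTorus.mFourier, ContinuousMap.coe_mk]
  rw [integral_fintype_prod_eq_prod (𝕜 := ℂ) (f := fun i t => fourier (k i) t)]
  exact Finset.prod_eq_zero (Finset.mem_univ i) (integral_fourier_haarAddCircle hi)

/-- Sequences that stay in a proper closed subset of the torus are uniformly not equidistributed:
a finite set of characters detects it, with a uniform constant. -/
theorem exists_finset_mFourier_sum_large {ι : Type*} [Fintype ι] {A : Set (UnitAddTorus ι)}
    (hA : IsClosed A) (hne : A ≠ Set.univ) :
    ∃ F : Finset (ι → ℤ), (∀ k ∈ F, k ≠ 0) ∧ ∃ η : ℝ, 0 < η ∧ η ≤ 1 ∧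
      ∀ x : ℕ → UnitAddTorus ι, (∀ j, x j ∈ A) → ∀ n : ℕ, 0 < n →
        ∃ k ∈ F, η * n ≤ ‖∑ j ∈ Finset.range n, UnitAddTorus.mFourier k (x j)‖ := by
  classical
  set μ : Measure (UnitAddTorus ι) := Measure.pi fun _ => AddCircle.haarAddCircle with hμ
  obtain ⟨p, hp⟩ := (Set.ne_univ_iff_exists_notMem A).1 hne
  obtain ⟨f, hfA, hfp, hf01⟩ := exists_continuous_zero_one_of_isClosed hA
    (isClosed_singleton (x := p)) (Set.disjoint_singleton_right.2 hp)
  set I := ∫ t, f t ∂μ with hI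
  have hIpos : 0 < I := by
    refine f.continuous.integral_pos_of_hasCompactSupport_nonneg_nonzero
      (HasCompactSupport.of_compactSpace f) (fun x => (hf01 x).1) (x := p) ?_
    rw [hfp rfl]; exact one_ne_zero
  let g : C(UnitAddTorus ι, ℂ) := ⟨fun t => (f t : ℂ), by fun_prop⟩
  have hgmem : g ∈ closure
      (Submodule.span ℂ (Set.range (UnitAddTorus.mFourier (d := ι))) : Set C(UnitAddTorus ι, ℂ)) := by
    rw [← Submodule.topologicalClosure_coe, UnitAddTorus.span_mFourier_closure_eq_top]
    trivial
  -- With error `I / 4`, the mean `c 0` of `P` has norm at least `3I/4`, while averages of `P` over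
  -- points of `A` are at most `I / 4`; the nonconstant terms must supply the difference.
  obtain ⟨P, hP, hgP⟩ := Metric.mem_closure_iff.1 hgmem (I / 4) (by positivity)
  rw [dist_eq_norm] at hgP
  obtain ⟨c, rfl⟩ := Finsupp.mem_span_range_iff_exists_finsupp.1 hP
  set P : C(UnitAddTorus ι, ℂ) := c.sum fun k a => a • UnitAddTorus.mFourier k with hPdef
  set F := c.support.erase 0 with hF
  have hPapply : ∀ t, P t = c 0 + ∑ k ∈ F, c k * UnitAddTorus.mFourier k t := by
    intro t
    have h1 : P t = ∑ k ∈ c.support, c k * UnitAddTorus.mFourier k t := by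
      simp [hPdef, Finsupp.sum]
    -- The frequency `0` is inserted because it need not lie in the support of `c`.
    have h2 : ∑ k ∈ insert 0 c.support, c k * UnitAddTorus.mFourier k t =
        ∑ k ∈ c.support, c k * UnitAddTorus.mFourier k t :=
      Finset.sum_insert_of_eq_zero_if_notMem fun h => by simp [Finsupp.notMem_support_iff.1 h]
    rw [h1, ← h2, ← Finset.add_sum_erase _ _ (Finset.mem_insert_self 0 _),
      Finset.erase_insert_eq_erase, UnitAddTorus.mFourier_zero]
    simp [hF]
  have hint : ∀ h : C(UnitAddTorus ι, ℂ), Integrable h μ := fun h =>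
    h.continuous.integrable_of_hasCompactSupport (HasCompactSupport.of_compactSpace h)
  have hPint : ∫ t, P t ∂μ = c 0 := by
    simp_rw [hPapply]
    rw [integral_add (integrable_const _)
      (integrable_finsetSum _ fun k _ => (hint _).const_mul _), integral_const,
      integral_finsetSum _ fun k _ => (hint _).const_mul _, Finset.sum_eq_zero]
    · simp
    · intro k hk
      rw [integral_const_mul, integral_mFourier (Finset.ne_of_mem_erase hk), mul_zero]
  have hgPt : ∀ t, ‖g t - P t‖ ≤ I / 4 := fun t =>
    ((g - P).norm_coe_le_norm t).trans hgP.le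
  have hc0 : ‖(I : ℂ) - c 0‖ ≤ I / 4 := by
    have hgint : ∫ t, g t ∂μ = I := integral_ofReal
    rw [← hgint, ← hPint, ← integral_sub (hint g) (hint P)]
    simpa using norm_integral_le_of_norm_le_const (μ := μ) (Eventually.of_forall hgPt)
  have hc0' : I * (3 / 4) ≤ ‖c 0‖ := by
    have h1 := norm_sub_norm_le (I : ℂ) (c 0)
    rw [Complex.norm_real, Real.norm_of_nonneg hIpos.le] at h1
    linarith
  set C := ∑ k ∈ F, ‖c k‖ with hC
  have hC0 : 0 ≤ C := Finset.sum_nonneg fun _ _ => norm_nonneg _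
  -- This `η` gives `η * C ≤ I / 4`, so if all sums were small then `3I/4 ≤ I/4 + I/4`. The `+ 1`
  -- covers `C = 0`.
  refine ⟨F, fun k hk => Finset.ne_of_mem_erase hk, min 1 (I / (4 * (C + 1))),
    lt_min one_pos (by positivity), min_le_left _ _, fun x hx n hn => ?_⟩
  set η := min 1 (I / (4 * (C + 1))) with hη
  have hηC : η * C ≤ I / 4 := by
    have h1 : η ≤ I / (4 * (C + 1)) := min_le_right _ _
    have h0 : 0 < η := lt_min one_pos (by positivity)
    rw [le_div_iff₀ (by positivity)] at h1
    nlinarith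
  by_contra! hcon
  have hn' : (0 : ℝ) < n := by exact_mod_cast hn
  have hupper : ‖∑ k ∈ F, c k * ∑ j ∈ Finset.range n, UnitAddTorus.mFourier k (x j)‖ ≤
      I / 4 * n := by
    calc _ ≤ ∑ k ∈ F, ‖c k‖ * (η * n) := by
          refine norm_sum_le_of_le _ fun k hk => ?_
          rw [norm_mul]
          exact mul_le_mul_of_nonneg_left (hcon k hk).le (norm_nonneg _)
      _ = (η * C) * n := by rw [← Finset.sum_mul, ← hC]; ring
      _ ≤ _ := by gcongr
  have hPx : ‖∑ j ∈ Finset.range n, P (x j)‖ ≤ I / 4 * n := by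
    calc _ ≤ ∑ j ∈ Finset.range n, I / 4 := by
          refine norm_sum_le_of_le _ fun j _ => ?_
          have h1 := hgPt (x j)
          have h2 : g (x j) = 0 := by simp [g, hfA (hx j)]
          rwa [h2, zero_sub, norm_neg] at h1
      _ = _ := by simp [mul_comm]
  have hsplit : ∑ j ∈ Finset.range n, P (x j) =
      n * c 0 + ∑ k ∈ F, c k * ∑ j ∈ Finset.range n, UnitAddTorus.mFourier k (x j) := by
    simp_rw [hPapply, Finset.sum_add_distrib, Finset.mul_sum]
    rw [Finset.sum_comm]; simp
  have hlow : ‖(n : ℂ) * c 0‖ ≤ I / 4 * n + I / 4 * n := by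
    rw [eq_sub_of_add_eq hsplit.symm]
    exact (norm_sub_le _ _).trans (add_le_add hPx hupper)
  rw [norm_mul, Complex.norm_natCast] at hlow
  nlinarith

/-! ### Base-`M` digits and the dimension of the exceptional set -/

theorem norm_exp_two_pi_I_sub_le (a b : ℝ) :
    ‖Complex.exp (2 * Real.pi * Complex.I * a) - Complex.exp (2 * Real.pi * Complex.I * b)‖ ≤
      2 * Real.pi * |a - b| := by
  have h1 : Complex.exp (2 * Real.pi * Complex.I * a) - Complex.exp (2 * Real.pi * Complex.I * b) =
      Complex.exp ((2 * Real.pi * b : ℝ) * Complex.I) *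
        (Complex.exp (Complex.I * (2 * Real.pi * (a - b) : ℝ)) - 1) := by
    rw [mul_sub, ← Complex.exp_add, mul_one]
    congr 2 <;> push_cast <;> ring
  rw [h1, norm_mul, Complex.norm_exp_ofReal_mul_I, one_mul]
  refine Real.norm_exp_I_mul_ofReal_sub_one_le.trans (le_of_eq ?_)
  rw [Real.norm_eq_abs, abs_mul, abs_of_pos Real.two_pi_pos]

/-- The points of `[m, m + 1)` whose fractional part has a base-`M` expansion starting with `w`. -/
def digitCylinder (M : ℕ) (m : ℤ) {n : ℕ} (w : Fin n → Fin M) : Set ℝ :=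
  {y | ⌊y⌋ = m ∧ ∀ i : Fin n, ⌊(M : ℝ) ^ ((i : ℕ) + 1) * y⌋ % (M : ℤ) = ((w i : ℕ) : ℤ)}

/-- Dividing `⌊M^(j+1) y⌋` by `M` leaves quotient `⌊M^j y⌋` and remainder the next digit, so integer
part and digits determine these floors inductively. -/
theorem floor_pow_mul_eq_of_mem_digitCylinder {M : ℕ} (hM : 0 < M) {m : ℤ} {n : ℕ}
    {w : Fin n → Fin M} {y z : ℝ} (hy : y ∈ digitCylinder M m w) (hz : z ∈ digitCylinder M m w) :
    ∀ j ≤ n, ⌊(M : ℝ) ^ j * y⌋ = ⌊(M : ℝ) ^ j * z⌋ := by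
  have hM' : (M : ℝ) ≠ 0 := by positivity
  have hdiv : ∀ (j : ℕ) (u : ℝ), ⌊(M : ℝ) ^ (j + 1) * u⌋ / (M : ℤ) = ⌊(M : ℝ) ^ j * u⌋ := by
    intro j u
    rw [← Int.floor_div_natCast]
    congr 1
    rw [div_eq_iff hM', pow_succ]
    ring
  intro j
  induction j with
  | zero => intro _; simp [hy.1, hz.1]
  | succ j ih =>
    intro hj
    rw [← Int.mul_ediv_add_emod ⌊(M : ℝ) ^ (j + 1) * y⌋ M,
      ← Int.mul_ediv_add_emod ⌊(M : ℝ) ^ (j + 1) * z⌋ M, hdiv, hdiv, ih (by omega)]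
    congr 1
    exact (hy.2 ⟨j, hj⟩).trans (hz.2 ⟨j, hj⟩).symm

theorem ediam_digitCylinder_le {M : ℕ} (hM : 0 < M) (m : ℤ) {n : ℕ} (w : Fin n → Fin M) :
    Metric.ediam (digitCylinder M m w) ≤ ((M : ℝ≥0∞)⁻¹) ^ n := by
  refine Metric.ediam_le fun y hy z hz => ?_
  have h1 := Int.abs_sub_lt_one_of_floor_eq_floor
    (floor_pow_mul_eq_of_mem_digitCylinder hM hy hz n le_rfl)
  have hMn : (0 : ℝ) < (M : ℝ) ^ n := by positivity
  rw [← mul_sub, abs_mul, abs_of_pos hMn, mul_comm, ← lt_div_iff₀ hMn] at h1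
  rw [edist_dist, Real.dist_eq]
  refine (ENNReal.ofReal_le_ofReal h1.le).trans (le_of_eq ?_)
  rw [one_div, ENNReal.ofReal_inv_of_pos hMn, ENNReal.ofReal_pow (by positivity),
    ENNReal.ofReal_natCast, ENNReal.inv_pow]

theorem exists_mem_digitCylinder {M : ℕ} (hM : 0 < M) (y : ℝ) (n : ℕ) :
    ∃ w : Fin n → Fin M, y ∈ digitCylinder M ⌊y⌋ w := by
  have hM' : (0 : ℤ) < M := by exact_mod_cast hM
  refine ⟨fun i => ⟨(⌊(M : ℝ) ^ ((i : ℕ) + 1) * y⌋ % (M : ℤ)).toNat, ?_⟩, rfl, fun i => ?_⟩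
  · rw [Int.toNat_lt (Int.emod_nonneg _ hM'.ne')]
    exact Int.emod_lt_of_pos _ hM'
  · exact (Int.toNat_of_nonneg (Int.emod_nonneg _ hM'.ne')).symm

/-- Modulo 1, truncating `M^i y` after one base-`M` digit gives `w i / M`, with error at most `1 /
M`. -/
theorem norm_exp_sub_digit_le {M : ℕ} (hM : 0 < M) {m : ℤ} {n : ℕ} {w : Fin n → Fin M} {y : ℝ}
    (hy : y ∈ digitCylinder M m w) (i : Fin n) :
    ‖Complex.exp (2 * Real.pi * Complex.I * ((M : ℝ) ^ (i : ℕ) * y : ℝ)) -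
      Complex.exp (2 * Real.pi * Complex.I / M) ^ (w i : ℕ)‖ ≤ 2 * Real.pi / M := by
  have hMR : (0 : ℝ) < M := by exact_mod_cast hM
  have hMC : (M : ℂ) ≠ 0 := by exact_mod_cast hM.ne'
  set a := ⌊(M : ℝ) ^ ((i : ℕ) + 1) * y⌋ with ha
  have hcast : (a : ℂ) = M * (a / (M : ℤ) : ℤ) + (w i : ℕ) := by
    have h := Int.mul_ediv_add_emod a M
    rw [hy.2 i] at h
    exact_mod_cast h.symm
  have h1 : Complex.exp (2 * Real.pi * Complex.I / M) ^ (w i : ℕ) =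
      Complex.exp (2 * Real.pi * Complex.I * ((a / M : ℝ) : ℂ)) := by
    rw [← Complex.exp_nat_mul]
    push_cast
    rw [hcast, Complex.exp_eq_exp_iff_exists_int]
    refine ⟨-(a / (M : ℤ)), ?_⟩
    push_cast
    field_simp
    ring
  rw [h1]
  refine (norm_exp_two_pi_I_sub_le _ _).trans ?_
  rw [← mul_one_div (2 * Real.pi)]
  gcongr
  have h2 : (M : ℝ) ^ (i : ℕ) * y - a / M = ((M : ℝ) ^ ((i : ℕ) + 1) * y - a) / M := by
    rw [pow_succ]
    field_simp
  rw [h2, abs_div, abs_of_pos hMR]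
  gcongr
  rw [ha, abs_of_nonneg (sub_nonneg.2 (Int.floor_le _))]
  linarith [Int.lt_floor_add_one ((M : ℝ) ^ ((i : ℕ) + 1) * y)]

/-- Converts the exponential saving `q` in the word count into a drop `δ` in dimension. -/
theorem exists_pos_rpow_mul_lt_one {a q : ℝ} (ha : 0 < a) (hq1 : q < 1) :
    ∃ δ : ℝ, 0 < δ ∧ δ ≤ 1 ∧ a ^ δ * q < 1 := by
  have h : Tendsto (fun δ : ℝ => a ^ δ * q) (𝓝[>] 0) (𝓝 (a ^ (0 : ℝ) * q)) :=
    (((Real.continuous_const_rpow ha.ne').tendsto 0).mul_const q).mono_left nhdsWithin_le_nhds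
  rw [Real.rpow_zero, one_mul] at h
  have h2 : ∀ᶠ δ : ℝ in 𝓝[>] 0, δ ∈ Set.Ioc (0 : ℝ) 1 := Ioc_mem_nhdsGT one_pos
  obtain ⟨δ, h3, h4⟩ := ((h.eventually (gt_mem_nhds hq1)).and h2).exists
  exact ⟨δ, h4.1, h4.2, h3⟩

/-- The set of `y` for which the averages of `exp (2πi M^j y)` are infinitely often bounded away
from `0` has Hausdorff dimension less than one. -/
theorem exists_dimH_frequently_large_sum_le {η : ℝ} (hη : 0 < η) (hη1 : η ≤ 1) {M : ℕ} (hM : 2 ≤ M)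
    (hMη : 4 * Real.pi ≤ η * M) :
    ∃ s : ℝ≥0, s < 1 ∧ dimH {y : ℝ | ∃ᶠ n : ℕ in atTop, η * n ≤
      ‖∑ j ∈ Finset.range n, Complex.exp (2 * Real.pi * Complex.I * ((M : ℝ) ^ j * y : ℝ))‖} ≤
        s := by
  classical
  have hM0 : 0 < M := by omega
  have hMR : (0 : ℝ) < M := by exact_mod_cast hM0
  set ω := Complex.exp (2 * Real.pi * Complex.I / M) with hω
  have hprim : IsPrimitiveRoot ω M := Complex.isPrimitiveRoot_exp M hM0.ne'
  have hz0 : ∑ a : Fin M, ω ^ (a : ℕ) = 0 := by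
    rw [Fin.sum_univ_eq_sum_range fun a => ω ^ a]
    exact hprim.geom_sum_eq_zero (by omega)
  have hz1 : ∀ a : Fin M, ‖ω ^ (a : ℕ)‖ ≤ 1 := fun a => by
    rw [norm_pow, hprim.norm'_eq_one hM0.ne', one_pow]
  set q := Real.exp (-((η / 4) ^ 2 / 4)) with hq
  have hq1 : q < 1 := Real.exp_lt_one_iff.2 (neg_lt_zero.2 (by positivity))
  obtain ⟨δ, hδ, hδ1, hlt⟩ := exists_pos_rpow_mul_lt_one hMR hq1
  obtain ⟨s, hs⟩ : ∃ s : ℝ≥0, (s : ℝ) = 1 - δ := ⟨⟨1 - δ, by linarith⟩, rfl⟩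
  refine ⟨s, by rw [← NNReal.coe_lt_coe, hs]; simpa using hδ, ?_⟩
  set S := {y : ℝ | ∃ᶠ n : ℕ in atTop, η * n ≤
      ‖∑ j ∈ Finset.range n, Complex.exp (2 * Real.pi * Complex.I * ((M : ℝ) ^ j * y : ℝ))‖}
  -- Cylinders fix the integer part; countable stability of `dimH` allows treating one integer part
  -- at a time.
  have hcover : S = ⋃ m : ℤ, S ∩ {y | ⌊y⌋ = m} := by
    ext y; simp
  rw [hcover, dimH_iUnion]
  refine iSup_le fun m => ?_
  have hb : (M : ℝ≥0∞)⁻¹ < 1 := by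
    rw [ENNReal.inv_lt_one]; exact_mod_cast (by omega : 1 < M)
  -- The threshold for words is `η / 2` per digit: the other half of `η` absorbs the digit error `2π
  -- / M`.
  refine dimH_le_of_frequently_mem_cover (ι := fun n =>
      {w : Fin n → Fin M // 2 * (η / 4) * n ≤ ‖∑ i, ω ^ (w i : ℕ)‖}) hb
    (fun n w => digitCylinder M m w.1) (fun n w => ediam_digitCylinder_le hM0 m w.1) ?_ ?_
  -- At most `4 (M q)^n` words, each costing at most `M^(-(1 - δ) n)`, give a geometric series.
  · have hterm : ∀ n : ℕ, ∑' w : {w : Fin n → Fin M // 2 * (η / 4) * n ≤ ‖∑ i, ω ^ (w i : ℕ)‖},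
        Metric.ediam (digitCylinder M m w.1) ^ (s : ℝ) ≤
          ENNReal.ofReal (4 * ((M : ℝ) ^ δ * q) ^ n) := by
      intro n
      have hcard := card_words_norm_sum_ge_le hz1 hz0 (σ := η / 4) (by positivity) (by linarith) n
      rw [Fintype.card_fin, ← hq] at hcard
      set B := {w : Fin n → Fin M // 2 * (η / 4) * n ≤ ‖∑ i, ω ^ (w i : ℕ)‖}
      have hpow : (((M : ℝ≥0∞)⁻¹) ^ n) ^ (s : ℝ) = ENNReal.ofReal (((M : ℝ) ^ (δ - 1)) ^ n) := by
        rw [ENNReal.ofReal_pow (by positivity), ← ENNReal.ofReal_rpow_of_pos hMR,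
          ENNReal.ofReal_natCast, ← ENNReal.rpow_natCast, ← ENNReal.rpow_mul, mul_comm (n : ℝ),
          ENNReal.rpow_mul, ENNReal.rpow_natCast, ENNReal.inv_rpow, ← ENNReal.rpow_neg]
        congr 2
        simp [hs]
      calc _ ≤ ∑' _ : B, ENNReal.ofReal (((M : ℝ) ^ (δ - 1)) ^ n) := by
            refine ENNReal.tsum_le_tsum fun w => ?_
            rw [← hpow]
            exact ENNReal.rpow_le_rpow (ediam_digitCylinder_le hM0 m w.1) s.2
        _ = ENNReal.ofReal ((Nat.card B : ℝ) * ((M : ℝ) ^ (δ - 1)) ^ n) := by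
            rw [tsum_fintype, Finset.sum_const, nsmul_eq_mul, ENNReal.ofReal_mul (by positivity),
              ENNReal.ofReal_natCast, Nat.card_eq_fintype_card, Finset.card_univ]
        _ ≤ _ := by
            refine ENNReal.ofReal_le_ofReal
              ((mul_le_mul_of_nonneg_right hcard (by positivity)).trans (le_of_eq ?_))
            rw [mul_assoc, ← mul_pow, Real.rpow_sub hMR, Real.rpow_one]
            congr 2
            field_simp
    refine ne_top_of_le_ne_top ?_ (ENNReal.tsum_le_tsum hterm)
    have hsum : Summable fun n : ℕ => 4 * ((M : ℝ) ^ δ * q) ^ n :=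
      (summable_geometric_of_lt_one (by positivity) hlt).mul_left 4
    exact hsum.tsum_ofReal_ne_top
  · rintro y ⟨hy, rfl⟩
    refine Frequently.mono hy fun n hn => ?_
    obtain ⟨w, hw⟩ := exists_mem_digitCylinder hM0 y n
    refine ⟨⟨w, ?_⟩, hw⟩
    rw [Finset.sum_range] at hn
    have hdiff : ‖∑ i : Fin n, Complex.exp (2 * Real.pi * Complex.I * ((M : ℝ) ^ (i : ℕ) * y : ℝ)) -
        ∑ i, ω ^ (w i : ℕ)‖ ≤ n * (2 * Real.pi / M) := by
      rw [← Finset.sum_sub_distrib]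
      refine (norm_sum_le_of_le _ fun i _ => norm_exp_sub_digit_le hM0 hw i).trans (le_of_eq ?_)
      simp
    have hMη' : 2 * Real.pi / M ≤ η / 2 := by
      rw [div_le_iff₀ hMR]; linarith
    have h2 : (n : ℝ) * (2 * Real.pi / M) ≤ n * (η / 2) := by gcongr
    have h3 := norm_sub_norm_le
      (∑ i : Fin n, Complex.exp (2 * Real.pi * Complex.I * ((M : ℝ) ^ (i : ℕ) * y : ℝ)))
      (∑ i, ω ^ (w i : ℕ))
    linarith

/-! ### From the cube to the torus -/

theorem isCompact_unitCube (d : ℕ) : IsCompact (unitCube d) := by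
  have h := (isCompact_univ_pi fun _ : Fin d => isCompact_Icc (a := (0 : ℝ)) (b := 1)).image
    (PiLp.continuous_toLp 2 fun _ : Fin d => ℝ)
  convert h
  ext x
  constructor
  · intro hx
    exact ⟨x.ofLp, fun i _ => hx i, rfl⟩
  · rintro ⟨y, hy, rfl⟩ i
    exact hy i trivial

theorem continuous_toTorus (d : ℕ) : Continuous (toTorus d) := by
  refine continuous_pi fun i => ?_
  exact (AddCircle.continuous_mk' 1).comp
    (by fun_prop : Continuous fun x : EuclideanSpace ℝ (Fin d) => x i)

/-- A closed proper subset of the cube misses an interior point of the cube. -/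
theorem exists_interior_notMem {d : ℕ} {K : Set (EuclideanSpace ℝ (Fin d))}
    (hK : K ⊂ unitCube d) (hclosed : IsClosed K) : ∃ p, p ∉ K ∧ ∀ i, p i ∈ Set.Ioo (0 : ℝ) 1 := by
  obtain ⟨p, hp, hpK⟩ := Set.exists_of_ssubset hK
  -- Moving slightly towards the centre of the cube reaches the interior without leaving the open
  -- complement of `K`.
  let c : EuclideanSpace ℝ (Fin d) := WithLp.toLp 2 fun _ => 1 / 2
  have hlim : Tendsto (fun t : ℝ => p + t • (c - p)) (𝓝[>] 0) (𝓝 p) := by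
    have h : Continuous fun t : ℝ => p + t • (c - p) := by fun_prop
    simpa using (h.tendsto 0).mono_left nhdsWithin_le_nhds
  have h1 := hlim.eventually (hclosed.isOpen_compl.mem_nhds hpK)
  have h2 : ∀ᶠ t : ℝ in 𝓝[>] 0, t ∈ Set.Ioo (0 : ℝ) 1 := Ioo_mem_nhdsGT one_pos
  obtain ⟨t, ht, ht0, ht1⟩ := (h1.and h2).exists
  refine ⟨_, ht, fun i => ?_⟩
  have hi := hp i
  have hci : c i = 1 / 2 := rfl
  simp only [PiLp.add_apply, PiLp.smul_apply, PiLp.sub_apply, smul_eq_mul, hci]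
  constructor <;> nlinarith [hi.1, hi.2]

/-- A missing boundary point could be represented on another face, but an interior point has only
one representative in the cube. -/
theorem toTorus_image_ne_univ {d : ℕ} {K : Set (EuclideanSpace ℝ (Fin d))}
    (hK : K ⊂ unitCube d) (hclosed : IsClosed K) : toTorus d '' K ≠ Set.univ := by
  obtain ⟨p, hpK, hp⟩ := exists_interior_notMem hK hclosed
  intro h
  obtain ⟨x, hx, hxp⟩ := h.ge (Set.mem_univ (toTorus d p))
  refine hpK ?_
  convert! hx
  ext i
  have hxi : ((x i : ℝ) : UnitAddCircle) = (p i : ℝ) := congrFun hxp i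
  have hpi := hp i
  have hxc := hK.subset hx i
  obtain ⟨n, hn⟩ := (AddCircle.coe_eq_zero_iff (1 : ℝ) (x := x i - p i)).1
    (by rw [AddCircle.coe_sub, hxi, sub_self])
  rw [zsmul_one] at hn
  have h1 : (-1 : ℝ) < n := by linarith [hpi.2, hxc.1]
  have h2 : (n : ℝ) < 1 := by linarith [hpi.1, hxc.2]
  have h3 : n = 0 := by
    have h1' : -1 < n := by exact_mod_cast h1
    have h2' : n < 1 := by exact_mod_cast h2
    omega
  rw [h3, Int.cast_zero] at hn
  linarith

/-! ### Characters along orbits, projections and the conclusion -/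

theorem iterate_timesN_apply (d N j : ℕ) (t : Fin d → UnitAddCircle) :
    (timesN d N)^[j] t = fun i => N ^ j • t i := by
  induction j with
  | zero => simp
  | succ j ih =>
    rw [Function.iterate_succ_apply', ih]
    ext i
    rw [timesN, smul_smul, pow_succ']

/-- The vector of `ℝ^d` with the given integer coordinates. -/
noncomputable def integerVector {d : ℕ} (k : Fin d → ℤ) : EuclideanSpace ℝ (Fin d) :=
  WithLp.toLp 2 fun i => (k i : ℝ)

theorem integerVector_ne_zero {d : ℕ} {k : Fin d → ℤ} (hk : k ≠ 0) : integerVector k ≠ 0 := by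
  intro h
  refine hk (funext fun i => ?_)
  have hi : integerVector k i = 0 := by rw [h]; rfl
  exact_mod_cast (show ((k i : ℤ) : ℝ) = 0 from hi)

theorem mFourier_iterate_timesN_toTorus {d : ℕ} (N j : ℕ) (k : Fin d → ℤ)
    (x : EuclideanSpace ℝ (Fin d)) :
    UnitAddTorus.mFourier k ((timesN d N)^[j] (toTorus d x)) =
      Complex.exp (2 * Real.pi * Complex.I *
        (((N : ℝ) ^ j * inner ℝ (integerVector k) x : ℝ) : ℂ)) := by
  rw [iterate_timesN_apply]
  have h : ∀ i, fourier (k i) (N ^ j • toTorus d x i) =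
      Complex.exp (2 * Real.pi * Complex.I * ((N : ℝ) ^ j * (k i * x i) : ℝ)) := by
    intro i
    rw [toTorus, ← AddCircle.coe_nsmul, fourier_coe_apply]
    congr 1
    push_cast
    simp
    ring
  simp only [UnitAddTorus.mFourier, ContinuousMap.coe_mk]
  simp_rw [h]
  rw [← Complex.exp_sum, ← Finset.mul_sum, ← Complex.ofReal_sum, ← Finset.mul_sum]
  congr 4
  simp [integerVector, PiLp.inner_apply, mul_comm]

/-- The projection of `x` is the image of `⟨v, x⟩` under the Lipschitz map `t ↦ t v / ‖v‖²`. -/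
theorem dimH_projectionInDirection_le {d : ℕ} (v : EuclideanSpace ℝ (Fin d))
    {E : Set (EuclideanSpace ℝ (Fin d))} {A : Set ℝ} (h : ∀ x ∈ E, inner ℝ v x ∈ A) :
    dimH (projectionInDirection v E) ≤ dimH A := by
  let L : ℝ →L[ℝ] EuclideanSpace ℝ (Fin d) :=
    ContinuousLinearMap.toSpanSingleton ℝ ((‖v‖ ^ 2)⁻¹ • v)
  refine (dimH_mono ?_).trans (L.lipschitz.dimH_image_le A)
  rintro _ ⟨x, hx, rfl⟩
  refine ⟨_, h x hx, ?_⟩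
  rw [Submodule.starProjection_singleton]
  simp [L, smul_smul, div_eq_mul_inv]

theorem theorem1p1 (d N : ℕ) (hd : 2 ≤ d) (hN : 2 ≤ N)
    (K : Set (EuclideanSpace ℝ (Fin d))) (hK : K ⊂ unitCube d) (hclosed : IsClosed K)
    (hinv : IsTimesNInvariant d N K) :
    ∃ c : NNReal, c < 1 ∧
      ∃ V : Finset (EuclideanSpace ℝ (Fin d)), (∀ v ∈ V, v ≠ 0) ∧
        ∃ E : EuclideanSpace ℝ (Fin d) → Set (EuclideanSpace ℝ (Fin d)),
          K = ⋃ v ∈ V, E v ∧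
          ∀ v ∈ V, dimH (projectionInDirection v (E v)) < (c : ENNReal) := by
  classical
  have hKc : IsCompact K := (isCompact_unitCube d).of_isClosed_subset hclosed hK.subset
  obtain ⟨F, hF, η, hη, hη1, hlarge⟩ := exists_finset_mFourier_sum_large
    (hKc.image (continuous_toTorus d)).isClosed (toTorus_image_ne_univ hK hclosed)
  -- Passing to the power `N ^ m` makes the digit error small compared with `η`, which is already
  -- fixed.
  obtain ⟨m, hm⟩ := pow_unbounded_of_one_lt (4 * Real.pi / η)
    (by exact_mod_cast hN : (1 : ℝ) < N)
  have hMη : 4 * Real.pi ≤ η * ((N ^ m : ℕ) : ℝ) := by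
    rw [div_lt_iff₀ hη] at hm
    push_cast
    linarith
  have hM : 2 ≤ N ^ m := by
    have h1 : η * ((N ^ m : ℕ) : ℝ) ≤ (N ^ m : ℕ) := mul_le_of_le_one_left (by positivity) hη1
    have h2 : (2 : ℝ) ≤ (N ^ m : ℕ) := by linarith [Real.pi_gt_three]
    exact_mod_cast h2
  obtain ⟨s, hs, hdim⟩ := exists_dimH_frequently_large_sum_le hη hη1 hM hMη
  set A := {y : ℝ | ∃ᶠ n : ℕ in atTop, η * n ≤ ‖∑ j ∈ Finset.range n,
    Complex.exp (2 * Real.pi * Complex.I * ((((N ^ m : ℕ) : ℝ) ^ j * y : ℝ) : ℂ))‖} with hA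
  -- The dimension bound `s` is not strict, so `c` is taken strictly between `s` and `1`.
  obtain ⟨c, hsc, hc⟩ := exists_between hs
  refine ⟨c, hc, F.image integerVector, ?_, fun v => {x ∈ K | inner ℝ v x ∈ A}, ?_, ?_⟩
  · simp only [Finset.mem_image]
    rintro _ ⟨k, hk, rfl⟩
    exact integerVector_ne_zero (hF k hk)
  · refine Set.Subset.antisymm (fun x hx => ?_) (Set.iUnion₂_subset fun v _ => Set.sep_subset _ _)
    have horbit : ∀ j, (timesN d N)^[j] (toTorus d x) ∈ toTorus d '' K := fun j =>
      hinv.iterate j ⟨x, hx, rfl⟩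
    have hev : ∃ᶠ n : ℕ in atTop, ∃ k ∈ F, η * n ≤ ‖∑ j ∈ Finset.range n,
        UnitAddTorus.mFourier k ((timesN d N)^[m * j] (toTorus d x))‖ :=
      (eventually_gt_atTop 0).frequently.mono fun n hn =>
        hlarge (fun j => (timesN d N)^[m * j] (toTorus d x)) (fun j => horbit _) n hn
    -- Pigeonhole: `F` is finite, so one frequency serves infinitely many `n`.
    obtain ⟨k, hk, hfreq⟩ : ∃ k ∈ F, ∃ᶠ n : ℕ in atTop, η * n ≤ ‖∑ j ∈ Finset.range n,
        UnitAddTorus.mFourier k ((timesN d N)^[m * j] (toTorus d x))‖ := by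
      by_contra! hcon
      refine hev ?_
      filter_upwards [(Filter.eventually_all_finset F).2 hcon] with n hn
      rintro ⟨k, hk, h⟩
      exact (hn k hk).not_ge h
    refine Set.mem_iUnion₂.2 ⟨integerVector k, Finset.mem_image_of_mem _ hk, hx, ?_⟩
    simpa only [hA, Set.mem_ofPred_eq, mFourier_iterate_timesN_toTorus, pow_mul,
      Nat.cast_pow] using hfreq
  · intro v _
    exact ((dimH_projectionInDirection_le v fun x hx => hx.2).trans hdim).trans_lt
      (by exact_mod_cast hsc)
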